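/- Let $d\ge 3$ be an integer and $c>0$ a real number. There is no randomised Monte Carlo algorithm in the LOCAL model that, for some function $T\colon\mathbb N\to\mathbb N$ with $T(n)=o(\log\log n)$, runs for $T(n)$ synchronous communication rounds in every network with $n$ nodes and, for all sufficiently large $n$, finds a sinkless orientation with probability at least $1-1/n^{c}$ in every connected $d$-regular simple graph on $n$ nodes that is given together with a proper edge colouring with $d$ colours. In particular, for no $d\ge 3$ can a sinkless orientation of $d$-regular graphs be found with high probability in $o(\log\log n)$ rounds. Here all nodes execute the same algorithm. Initially a node knows the number $n$ of nodes, the maximum degree, the colours of its incident edges, and its own random number; the random numbers of the nodes are independent and uniform in $[0,1]$. In each round every node sends a message to each neighbour, receives a message from each neighbour, and updates its state; message sizes and local computation are unbounded (the outputs, as functions of the random numbers, are only required to be measurable). After $T(n)$ rounds every node announces a direction for each of its incident edges. The algorithm finds a sinkless orientation if the two endpoints of every edge announce the same direction and, in the resulting orientation, every node has at least one outgoing edge. -/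

import Mathlib

open Filter Asymptotics MeasureTheory

universe u v w

namespace Distributed

section Graphs

variable {V : Type w} {G : SimpleGraph V}

/-- An orientation of a simple graph: every edge `{a, b}` is directed in exactly one of the two
ways, `dir a b` meaning `a → b`. -/
structure Orientation (G : SimpleGraph V) where
  dir : V → V → Prop
  adj_of_dir : ∀ {a b : V}, dir a b → G.Adj a b
  dir_iff_not_dir : ∀ {a b : V}, G.Adj a b → (dir a b ↔ ¬ dir b a)

/-- The number of edges that leave the node `a`. -/
noncomputable def Orientation.outdeg (σ : Orientation G) (a : V) : ℕ :=
  Set.ncard {b | σ.dir a b}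

/-- No node is a sink. -/
def Orientation.Sinkless (σ : Orientation G) : Prop :=
  ∀ a : V, 0 < σ.outdeg a

/-- A proper edge colouring with `k` colours: distinct edges that share an endpoint have different
colours. -/
abbrev EdgeColouring (G : SimpleGraph V) (k : ℕ) : Type w :=
  G.lineGraph.Coloring (Fin k)

/-- The colour of the edge `{a, b}`. -/
def EdgeColouring.colour {k : ℕ} (ψ : EdgeColouring G k) {a b : V} (h : G.Adj a b) : Fin k :=
  ψ ⟨s(a, b), h⟩

/-- The colours of the edges at the node `a`. -/
def EdgeColouring.coloursAt {k : ℕ} (ψ : EdgeColouring G k) (a : V) : Set (Fin k) :=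
  {i | ∃ (b : V) (h : G.Adj a b), i = ψ.colour h}

end Graphs

/-- A randomised algorithm of the LOCAL model on networks with a proper edge `k`-colouring.
All nodes run the same algorithm. A node tells its neighbours apart by the colours of the
connecting edges. State and message spaces are arbitrary, and so is the local computation. -/
structure LocalAlgorithm (k : ℕ) (Out : Type w) where
  /-- the local states of a node -/
  State : Type u
  /-- the messages -/
  Msg : Type v
  /-- the initial state of a node that is given the number of nodes, the maximum degree, the colours
  of its incident edges, and its random number in `[0, 1]` -/
  init : ℕ → ℕ → Set (Fin k) → unitInterval → State
  /-- the message that a node in a given state sends along its edge of a given colour -/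
  send : State → Fin k → Msg
  /-- the new state of a node after it has received, for each of its edges, the pair that consists of
  the colour of the edge and the message that arrived along it -/
  receive : State → Set (Fin k × Msg) → State
  /-- the output that a node in a given state announces when it stops -/
  output : State → Out

namespace LocalAlgorithm

variable {k : ℕ} {Out : Type w} (A : LocalAlgorithm.{u, v, w} k Out)
  {V : Type} [Fintype V] (G : SimpleGraph V) [DecidableRel G.Adj] (ψ : EdgeColouring G k)

/-- The states of all nodes after `t` synchronous rounds, when `x a` is the random number of the
node `a`. -/
def stateAfter (x : V → unitInterval) : ℕ → V → A.State
  | 0 => fun a => A.init (Fintype.card V) G.maxDegree (ψ.coloursAt a) (x a)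
  | t + 1 => fun a =>
      A.receive (stateAfter x t a)
        {m | ∃ (b : V) (h : G.Adj a b),
          m = (ψ.colour h, A.send (stateAfter x t b) (ψ.colour h))}

/-- The outputs of all nodes when they stop after `t` rounds. -/
def outputAfter (t : ℕ) (x : V → unitInterval) (a : V) : Out :=
  A.output (A.stateAfter G ψ x t a)

end LocalAlgorithm

section SinklessOrientation

variable {V : Type} {d : ℕ}

/-- The local outputs `o` form a sinkless orientation. Here `o a i = true` means that the node `a`
announces its edge of colour `i` to be directed away from `a`; the two endpoints of every edge have
to announce the same direction. -/
def IsSinklessOutput (G : SimpleGraph V) (ψ : EdgeColouring G d) (o : V → Fin d → Bool) : Prop :=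
  ∃ σ : Orientation G, σ.Sinkless ∧
    ∀ (a b : V) (h : G.Adj a b), o a (ψ.colour h) = true ↔ σ.dir a b

/-- `A`, run for `T n` rounds in networks with `n` nodes, finds a sinkless orientation with
probability at least `1 - 1 / n ^ c` in every sufficiently large connected `d`-regular graph with
a given proper edge `d`-colouring. The random numbers of the nodes are independent and uniform in
`[0, 1]`, and the outputs of the nodes are random variables. -/
def SolvesSinklessOrientation (A : LocalAlgorithm.{u, v} d (Fin d → Bool)) (T : ℕ → ℕ) (c : ℝ) :
    Prop :=
  ∃ n₀ : ℕ, ∀ (V : Type) [Fintype V] (G : SimpleGraph V) [DecidableRel G.Adj]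
    (ψ : EdgeColouring G d),
    n₀ ≤ Fintype.card V → G.Connected → G.IsRegularOfDegree d →
      (∀ a : V, Measurable fun x : V → unitInterval =>
        A.outputAfter G ψ (T (Fintype.card V)) x a) ∧
      1 - 1 / (Fintype.card V : ℝ) ^ c ≤
        (volume : Measure (V → unitInterval)).real
          {x | IsSinklessOutput G ψ (A.outputAfter G ψ (T (Fintype.card V)) x)}

end SinklessOrientation

end Distributed

/-! The proof is by round elimination on a homogeneous, locally tree-like network. Moving along the
edges of a fixed colour is an involution of a ball of the `d`-regular tree; these involutions `s i`
generate a finite group, and the network is its Cayley graph with edges `{g, g * s i}` of colour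
`i`. Left translations preserve the colours, so a `t`-round algorithm is one function of the labels
in the `t`-ball of `1`.

In a sinkless orientation let every node name the colour of an outgoing edge: no edge of colour `i`
has both ends naming `i`. Such a colouring with views of radius `t + 1` gives an orientation by
half-edges that sees the `t`-balls of both ends of an edge (`exists_orientation`), and this gives a
colouring with views of radius `t` (`exists_colouring`). Both passages threshold a conditional
probability, and both rest on conditional independence in a tree. Eliminating a round turns a
failure bound `p` into a constant times `p ^ (1 / (3 * (d + 1)))` (`speedUp`). At radius `0` the
ends of an edge choose independently, so failure cannot be rare; hence failure at radius `t` is at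
least doubly exponentially small in `t` (`exists_lt_measure`). The group has order at most `((d + 1)
^ R)!`, so `log (log n) = O(R)`: for `T n = o(log (log n))` the views stay tree-like and this lower
bound is at least `1 / n ^ c` (`eventually_of_isLittleO`). -/

namespace Distributed

open scoped ENNReal

/-! ### Conditional means over independent coordinates -/

section CondMean

variable {ι Ω : Type*} [Fintype ι] [MeasurableSpace Ω] (μ : Measure Ω)

open Classical in
/-- The conditional mean of `φ`, given the coordinates in `S`, for independent coordinates with
distribution `μ`. -/
noncomputable def condMean (S : Set ι) (φ : (ι → Ω) → ℝ≥0∞) : (ι → Ω) → ℝ≥0∞ :=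
  lmarginal (fun _ => μ) (Finset.univ.filter (· ∉ S)) φ

lemma condMean_dependsOn (S : Set ι) (φ : (ι → Ω) → ℝ≥0∞) : DependsOn (condMean μ S φ) S :=
  by classical exact fun x y h => lmarginal_congr _ _ fun i hi => h i (by simpa using hi)

lemma lmarginal_mul_left {ι Ω : Type*} [DecidableEq ι] [MeasurableSpace Ω] (μ : Measure Ω)
    (s : Finset ι) {φ χ : (ι → Ω) → ℝ≥0∞} (hχ : Measurable χ)
    {S : Set ι} (hφ : DependsOn φ S) (hS : ∀ i ∈ s, i ∉ S) :
    lmarginal (fun _ => μ) s (fun x => φ x * χ x) =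
      fun x => φ x * lmarginal (fun _ => μ) s χ x := by
  funext x
  have h : ∀ y, φ (Function.updateFinset x s y) = φ x := fun y => hφ fun i hi => by
    have : i ∉ s := fun h => hS i h hi
    simp [Function.updateFinset, this]
  simp only [lmarginal, h]
  exact lintegral_const_mul _ (hχ.comp measurable_updateFinset)

lemma condMean_mul_left {S : Set ι} {φ χ : (ι → Ω) → ℝ≥0∞} (hχ : Measurable χ)
    (hφ : DependsOn φ S) :
    condMean μ S (fun x => φ x * χ x) = fun x => φ x * condMean μ S χ x := by
  classical
  exact lmarginal_mul_left μ _ hχ hφ (by simp)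

variable [IsProbabilityMeasure μ]

lemma measurable_condMean {S : Set ι} {φ : (ι → Ω) → ℝ≥0∞} (hφ : Measurable φ) :
    Measurable (condMean μ S φ) := by
  classical exact hφ.lmarginal _

lemma condMean_const (S : Set ι) (a : ℝ≥0∞) : condMean μ S (fun _ => a) = fun _ => a := by
  funext x; simp [condMean, lmarginal]

lemma condMean_empty (φ : (ι → Ω) → ℝ≥0∞) :
    condMean μ ∅ φ = fun _ => ∫⁻ x, φ x ∂Measure.pi fun _ => μ := by
  classical
  simp [condMean]

lemma lintegral_condMean (S : Set ι) {φ : (ι → Ω) → ℝ≥0∞} (hφ : Measurable φ) :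
    ∫⁻ x, condMean μ S φ x ∂(Measure.pi fun _ => μ) = ∫⁻ x, φ x ∂(Measure.pi fun _ => μ) := by
  classical
  refine lintegral_eq_of_lmarginal_eq (Finset.univ.filter (· ∉ S)) (measurable_condMean μ hφ) hφ ?_
  -- Taking the conditional mean twice changes nothing, so both sides have the same marginal.
  have h := condMean_mul_left μ (S := S) (φ := condMean μ S φ) (χ := fun _ => 1) measurable_const
    (condMean_dependsOn μ S φ)
  rw [condMean_const] at h
  simpa [condMean] using h

/-- Functions of coordinates that only overlap in `S` are conditionally independent given the
coordinates in `S`. -/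
lemma condMean_mul {S A B : Set ι} {φ χ : (ι → Ω) → ℝ≥0∞} (hφm : Measurable φ)
    (hχm : Measurable χ) (hφ : DependsOn φ A) (hχ : DependsOn χ B) (hAB : A ∩ B ⊆ S) :
    condMean μ S (fun x => φ x * χ x) = fun x => condMean μ S φ x * condMean μ S χ x := by
  classical
  -- The coordinates outside `S` split into `s`, which `φ` ignores, and `t`, which `χ` ignores.
  -- Integrating over `s` first leaves a factor from `χ` that depends on `S` only and so comes out
  -- of the integral over `t`.
  let s : Finset ι := Finset.univ.filter fun i => i ∉ S ∧ i ∉ A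
  let t : Finset ι := Finset.univ.filter fun i => i ∉ S ∧ i ∈ A
  have hst : Disjoint s t := by
    rw [Finset.disjoint_left]; intro i; simp [s, t]; tauto
  have hun : Finset.univ.filter (· ∉ S) = s ∪ t := by
    ext i; simp [s, t]; tauto
  have hsφ : ∀ i ∈ s, i ∉ A := by simp [s]
  have htχ : ∀ i ∈ t, i ∉ B := by
    simp only [t, Finset.mem_filter, Finset.mem_univ, true_and]
    exact fun i hi hB => hi.1 (hAB ⟨hi.2, hB⟩)
  have hconst : ∀ (r : Finset ι) (a : ℝ≥0∞),
      lmarginal (fun _ : ι => μ) r (fun _ => a) = fun _ => a := by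
    intro r a; funext x; simp [lmarginal]
  have e1 : lmarginal (fun _ => μ) s φ = φ := by
    have := lmarginal_mul_left μ s (χ := fun _ => 1) measurable_const hφ hsφ
    rw [hconst] at this
    simpa using this
  have e2 : lmarginal (fun _ => μ) t χ = χ := by
    have := lmarginal_mul_left μ t (χ := fun _ => 1) measurable_const hχ htχ
    rw [hconst] at this
    simpa using this
  have e3 : lmarginal (fun _ => μ) (s ∪ t) φ = lmarginal (fun _ => μ) t φ := by
    rw [lmarginal_union' _ _ hφm hst, e1]
  have e4 : lmarginal (fun _ => μ) (s ∪ t) χ = lmarginal (fun _ => μ) s χ := by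
    rw [lmarginal_union _ _ hχm hst, e2]
  have hd : DependsOn (lmarginal (fun _ => μ) s χ) S := by
    rw [← e4, ← hun]
    exact condMean_dependsOn μ S χ
  rw [condMean, condMean, condMean, hun, e3, e4, lmarginal_union' _ (fun x => φ x * χ x)
    (hφm.mul hχm) hst, lmarginal_mul_left μ s hχm hφ hsφ]
  have := lmarginal_mul_left μ t hφm hd (by simp +contextual [t])
  funext x
  have := congrFun this x
  simp only [mul_comm] at this ⊢
  exact this

lemma condMean_prod {κ : Type*} (r : Finset κ) {S : Set ι} {A : κ → Set ι}
    {φ : κ → (ι → Ω) → ℝ≥0∞} (hφm : ∀ k, Measurable (φ k)) (hφ : ∀ k, DependsOn (φ k) (A k))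
    (hA : ∀ k l, k ≠ l → A k ∩ A l ⊆ S) :
    condMean μ S (fun x => ∏ k ∈ r, φ k x) = fun x => ∏ k ∈ r, condMean μ S (φ k) x := by
  classical
  induction r using Finset.induction with
  | empty => simpa using condMean_const μ S 1
  | insert k r hk ih =>
    simp only [Finset.prod_insert hk]
    rw [condMean_mul μ (hφm k) (Finset.measurable_prod r fun l _ => hφm l) (hφ k)
      (B := ⋃ l ∈ r, A l), ih]
    · intro x y h
      refine Finset.prod_congr rfl fun l hl => hφ l fun i hi => h i ?_
      exact Set.mem_biUnion hl hi
    · rintro i ⟨h1, h2⟩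
      simp only [Set.mem_iUnion] at h2
      obtain ⟨l, hl, h2⟩ := h2
      exact hA k l (fun h => hk (h ▸ hl)) ⟨h1, h2⟩

/-- Relabelling the coordinates commutes with conditional means. -/
lemma condMean_comp_equiv (e : ι ≃ ι) {S S' : Set ι} (h : ∀ i, e i ∈ S' ↔ i ∈ S)
    {φ : (ι → Ω) → ℝ≥0∞} (hφ : Measurable φ) (x : ι → Ω) :
    condMean μ S' (fun y => φ fun i => y (e i)) x = condMean μ S φ fun i => x (e i) := by
  classical
  have := lmarginal_image (X := fun _ : ι => Ω) (μ := fun _ => μ) e.injective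
    (Finset.univ.filter (· ∉ S)) hφ x
  have hS : (Finset.univ.filter (· ∉ S)).image e = Finset.univ.filter (· ∉ S') := by
    ext i
    obtain ⟨j, rfl⟩ := e.surjective i
    simp [h]
  rw [hS] at this
  exact this

lemma measurePreserving_comp_equiv (e : ι ≃ ι) :
    MeasurePreserving (fun (x : ι → Ω) i => x (e i)) (Measure.pi fun _ => μ)
      (Measure.pi fun _ => μ) := by
  have := measurePreserving_piCongrLeft (fun _ : ι => μ) e.symm
  convert this using 1
  funext x i
  simp [MeasurableEquiv.piCongrLeft, Equiv.piCongrLeft_apply]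

/-- An event is unlikely to happen when its conditional probability is small. -/
lemma measure_condMean_le {S : Set ι} {E : Set (ι → Ω)} (hE : MeasurableSet E) (δ : ℝ≥0∞) :
    (Measure.pi fun _ => μ) (E ∩ {x | condMean μ S (E.indicator 1) x ≤ δ}) ≤ δ := by
  set D : Set (ι → Ω) := {x | condMean μ S (E.indicator 1) x ≤ δ}
  have hEm : Measurable (E.indicator (1 : (ι → Ω) → ℝ≥0∞)) := measurable_one.indicator hE
  have hD : MeasurableSet D := measurableSet_le (measurable_condMean μ hEm) measurable_const
  have hDm : Measurable (D.indicator (1 : (ι → Ω) → ℝ≥0∞)) := measurable_one.indicator hD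
  -- The event `D` is decided by the coordinates in `S`, so its indicator can be pulled out of the
  -- conditional mean.
  have hdep : DependsOn (D.indicator (1 : (ι → Ω) → ℝ≥0∞)) S := fun x y h => by
    have : x ∈ D ↔ y ∈ D := by
      change _ ≤ δ ↔ _ ≤ δ
      rw [condMean_dependsOn μ S _ h]
    by_cases hx : x ∈ D <;> simp [Set.indicator, ← this, hx]
  calc (Measure.pi fun _ => μ) (E ∩ D)
      = ∫⁻ x, D.indicator 1 x * E.indicator 1 x ∂(Measure.pi fun _ => μ) := by
        rw [← lintegral_indicator_one (hE.inter hD)]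
        refine lintegral_congr fun x => ?_
        by_cases h1 : x ∈ E <;> by_cases h2 : x ∈ D <;> simp [h1, h2]
    _ = ∫⁻ x, D.indicator 1 x * condMean μ S (E.indicator 1) x ∂(Measure.pi fun _ => μ) := by
        refine (lintegral_condMean μ S (hDm.mul hEm)).symm.trans ?_
        exact lintegral_congr fun x => congrFun (condMean_mul_left μ hEm hdep) x
    _ ≤ ∫⁻ _, δ ∂(Measure.pi fun _ => μ) := by
        refine lintegral_mono fun x => ?_
        by_cases h : x ∈ D
        · rw [Set.indicator_of_mem h, Pi.one_apply, one_mul]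
          exact h
        · simp [h]
    _ = δ := by simp

end CondMean

/-! ### Reduced words in involutions -/

section Words

variable {Γ κ : Type*} [Group Γ] (s : κ → Γ)

/-- The elements of a group with generators `s` that are products of reduced words of length at
most `t`. -/
def wordBall (t : ℕ) : Set Γ :=
  {g | ∃ w : List κ, w.IsChain (· ≠ ·) ∧ w.length ≤ t ∧ (w.map s).prod = g}

/-- Involutions `s` without relations between reduced words of length at most `R`. -/
structure FreeUpTo (R : ℕ) : Prop where
  mul_self : ∀ i, s i * s i = 1
  inj : ∀ w w' : List κ, w.IsChain (· ≠ ·) → w'.IsChain (· ≠ ·) → w.length ≤ R → w'.length ≤ R →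
    (w.map s).prod = (w'.map s).prod → w = w'

variable {s} {R : ℕ}

lemma wordBall_mono {t t' : ℕ} (h : t ≤ t') : wordBall s t ⊆ wordBall s t' :=
  fun _ ⟨w, hw, hl, hg⟩ => ⟨w, hw, hl.trans h, hg⟩

lemma one_mem_wordBall (t : ℕ) : (1 : Γ) ∈ wordBall s t :=
  ⟨[], List.isChain_nil, by simp, by simp⟩

lemma wordBall_zero : wordBall s 0 = {1} := by
  ext g
  constructor
  · rintro ⟨w, -, hl, rfl⟩
    simp [List.length_eq_zero_iff.mp (Nat.le_zero.mp hl)]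
  · rintro rfl
    exact one_mem_wordBall 0

namespace FreeUpTo

variable (hs : FreeUpTo s R)
include hs

lemma mul_cancel_left (i : κ) (g : Γ) : s i * (s i * g) = g := by
  rw [← mul_assoc, hs.mul_self, one_mul]

lemma mul_cancel_right (i : κ) (g : Γ) : g * s i * s i = g := by
  rw [mul_assoc, hs.mul_self, mul_one]

/-- Either `i :: w` is reduced or a letter cancels. -/
lemma isChain_cons_or {w : List κ} (hw : w.IsChain (· ≠ ·)) (i : κ) :
    (i :: w).IsChain (· ≠ ·) ∨ ∃ w' : List κ, w'.IsChain (· ≠ ·) ∧ w'.length + 1 = w.length ∧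
      s i * (w.map s).prod = (w'.map s).prod := by
  cases w with
  | nil => exact .inl (List.isChain_singleton i)
  | cons j w =>
    by_cases h : i = j
    · subst h
      exact .inr ⟨w, hw.tail, rfl, by simp [hs.mul_cancel_left]⟩
    · exact .inl (List.isChain_cons_cons.mpr ⟨h, hw⟩)

lemma mul_mem_wordBall {t : ℕ} {g : Γ} (hg : g ∈ wordBall s t) (i : κ) :
    s i * g ∈ wordBall s (t + 1) := by
  obtain ⟨w, hw, hl, rfl⟩ := hg
  obtain h | ⟨w', hw', hl', e⟩ := hs.isChain_cons_or hw i
  · exact ⟨i :: w, h, by simpa using hl, by simp⟩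
  · exact ⟨w', hw', by omega, e.symm⟩

/-- In a tree, the `t + 1`-balls of the endpoints of an edge meet in the `t`-balls. -/
lemma mem_wordBall_of_mul_mem {t : ℕ} (ht : t + 2 ≤ R) {i : κ} {g : Γ}
    (hg : g ∈ wordBall s (t + 1)) (hig : s i * g ∈ wordBall s (t + 1)) :
    g ∈ wordBall s t ∨ s i * g ∈ wordBall s t := by
  obtain ⟨w, hw, hl, rfl⟩ := hg
  obtain ⟨w', hw', hl', e'⟩ := hig
  obtain h | ⟨w'', hw'', hl'', e⟩ := hs.isChain_cons_or hw i
  -- If no letter cancels, `i :: w` is the unique reduced word of `s i * g`, so its length is at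
  -- most `t + 1` and `w` is one shorter.
  · have := hs.inj _ _ h hw' (by simp; omega) (by omega) (by simp [e'])
    subst this
    exact .inl ⟨w, hw, by simpa using hl', rfl⟩
  · exact .inr ⟨w'', hw'', by omega, e.symm⟩

/-- In a tree, distinct neighbours of the root have `t`-balls that meet in the `t`-ball of the
root. -/
lemma mem_wordBall_of_ne {t : ℕ} (ht : t + 1 ≤ R) {i j : κ} (hij : i ≠ j) {g : Γ}
    (hi : s i * g ∈ wordBall s t) (hj : s j * g ∈ wordBall s t) : g ∈ wordBall s t := by
  obtain ⟨w, hw, hl, e⟩ := hi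
  obtain ⟨w', hw', hl', e'⟩ := hj
  obtain h | ⟨v, hv, hlv, ev⟩ := hs.isChain_cons_or hw i
  · obtain h' | ⟨v, hv, hlv, ev⟩ := hs.isChain_cons_or hw' j
    -- Without cancellation `g` would have two reduced words, one starting with `i` and one with
    -- `j`.
    · have := hs.inj _ _ h h' (by simp; omega) (by simp; omega)
        (by simp [e, e', hs.mul_cancel_left])
      exact absurd (List.cons.inj this).1 hij
    · exact ⟨v, hv, by omega, by rw [← ev, e', hs.mul_cancel_left]⟩
  · exact ⟨v, hv, by omega, by rw [← ev, e, hs.mul_cancel_left]⟩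

lemma ne_one (hR : 1 ≤ R) (i : κ) : s i ≠ 1 := fun h => by
  have := hs.inj [i] [] (List.isChain_singleton i) List.isChain_nil (by simpa) (by simp) (by simpa)
  simp at this

lemma injective (hR : 1 ≤ R) : Function.Injective s := fun i j h => by
  have := hs.inj [i] [j] (List.isChain_singleton i) (List.isChain_singleton j) (by simpa)
    (by simpa) (by simpa)
  simpa using this

end FreeUpTo

end Words

/-! ### A finite group that is free up to length `R` -/

section TreeBall

/-- The ball of radius `R` in the `d`-regular tree, as a set of reduced words. -/
abbrev TreeBall (d R : ℕ) : Type := {w : List (Fin d) // w.IsChain (· ≠ ·) ∧ w.length ≤ R}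

variable {d R : ℕ}

/-- Move along the edge of colour `i` if that edge belongs to the ball. -/
def treeMove (i : Fin d) (w : TreeBall d R) : TreeBall d R :=
  if h : w.1.head? = some i then ⟨w.1.tail, w.2.1.tail, by simpa using Nat.le_succ_of_le w.2.2⟩
  else if h' : w.1.length < R then
    ⟨i :: w.1, by
      obtain ⟨_ | ⟨j, w⟩, hw⟩ := w
      · exact List.isChain_singleton i
      · exact List.isChain_cons_cons.mpr ⟨fun e => h (by simp [e]), hw.1⟩, h'⟩
  else w

lemma treeMove_treeMove (i : Fin d) (w : TreeBall d R) : treeMove i (treeMove i w) = w := by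
  obtain ⟨w, hw, hl⟩ := w
  by_cases h : w.head? = some i
  · cases w with
    | nil => simp at h
    | cons j w =>
      obtain rfl : j = i := by simpa using h
      have h1 : w.head? ≠ some j := by
        cases w with
        | nil => simp
        | cons k w =>
          have := (List.isChain_cons_cons.mp hw).1
          simpa using this.symm
      have h2 : w.length < R := by simpa using hl
      simp [treeMove, h1, h2]
  · by_cases h' : w.length < R <;> simp [treeMove, h, h']

/-- The involution `treeMove i` as a permutation. -/
def treePerm (d R : ℕ) (i : Fin d) : Equiv.Perm (TreeBall d R) :=
  ⟨treeMove i, treeMove i, treeMove_treeMove i, treeMove_treeMove i⟩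

/-- A reduced word walks from the root without backtracking and stays inside the ball, so the image
of the root recovers the word. This yields freeness up to length `R`. -/
lemma treePerm_prod_apply (w : List (Fin d)) (hw : w.IsChain (· ≠ ·)) (hl : w.length ≤ R) :
    (w.map (treePerm d R)).prod ⟨[], List.isChain_nil, by simp⟩ = ⟨w, hw, hl⟩ := by
  induction w with
  | nil => simp
  | cons i w ih =>
    have hl' : w.length < R := by simpa using hl
    have h1 : w.head? ≠ some i := by
      cases w with
      | nil => simp
      | cons k w =>
        have := (List.isChain_cons_cons.mp hw).1
        simpa using this.symm
    rw [List.map_cons, List.prod_cons, Equiv.Perm.mul_apply, ih hw.tail hl'.le]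
    change treeMove i _ = _
    simp [treeMove, h1, hl']

lemma freeUpTo_treePerm (d R : ℕ) : FreeUpTo (treePerm d R) R where
  mul_self i := Equiv.ext fun w => treeMove_treeMove i w
  inj w w' hw hw' hl hl' h := by
    have := DFunLike.congr_fun h ⟨[], List.isChain_nil, by simp⟩
    rw [treePerm_prod_apply w hw hl, treePerm_prod_apply w' hw' hl'] at this
    exact congrArg Subtype.val this

/-- The coordinates of a word of length at most `R`. -/
def TreeBall.letters (w : TreeBall d R) : Fin R → Option (Fin d) := fun m => w.1[m.1]?

lemma TreeBall.letters_injective : Function.Injective (TreeBall.letters (d := d) (R := R)) := by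
  rintro ⟨w, hw⟩ ⟨w', hw'⟩ h
  refine Subtype.ext (List.ext_getElem? fun m => ?_)
  by_cases hm : m < R
  · exact congrFun h ⟨m, hm⟩
  · change w[m]? = w'[m]?
    rw [List.getElem?_eq_none (by omega), List.getElem?_eq_none (by omega)]

instance : Finite (TreeBall d R) := Finite.of_injective _ TreeBall.letters_injective

lemma card_treeBall_le (d R : ℕ) : Nat.card (TreeBall d R) ≤ (d + 1) ^ R := by
  have := Nat.card_le_card_of_injective _ (TreeBall.letters_injective (d := d) (R := R))
  simpa using this

/-- The group generated by the involutions of the tree ball. -/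
abbrev TreeGroup (d R : ℕ) : Type := Subgroup.closure (Set.range (treePerm d R))

/-- The generators of `TreeGroup d R`. -/
def treeGen (d R : ℕ) (i : Fin d) : TreeGroup d R :=
  ⟨treePerm d R i, Subgroup.subset_closure ⟨i, rfl⟩⟩

lemma freeUpTo_treeGen (d R : ℕ) : FreeUpTo (treeGen d R) R where
  mul_self i := Subtype.ext ((freeUpTo_treePerm d R).mul_self i)
  inj w w' hw hw' hl hl' h := (freeUpTo_treePerm d R).inj w w' hw hw' hl hl' (by
    have := congrArg (Subgroup.subtype _) h
    simpa [map_list_prod, Function.comp_def, treeGen] using this)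

lemma closure_treeGen (d R : ℕ) : Subgroup.closure (Set.range (treeGen d R)) = ⊤ := by
  have := Subgroup.closure_closure_coe_preimage (k := Set.range (treePerm d R))
  convert this using 2
  ext g
  simp [treeGen, Subtype.ext_iff]

lemma card_treeGroup_le (d R : ℕ) : Nat.card (TreeGroup d R) ≤ ((d + 1) ^ R).factorial := by
  refine (Nat.card_le_card_of_injective _ Subtype.val_injective).trans ?_
  rw [Nat.card_perm]
  exact Nat.factorial_le (card_treeBall_le d R)

/-- Alternating words in two colours are reduced, so those of lengths `0, …, R - 1` give distinct
elements. This makes the networks arbitrarily large. -/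
lemma le_card_treeGroup {d : ℕ} (hd : 2 ≤ d) (R : ℕ) : R ≤ Nat.card (TreeGroup d R) := by
  let a : ℕ → Fin d := fun m => if Even m then ⟨0, by omega⟩ else ⟨1, by omega⟩
  have ha : ∀ m, a m ≠ a (m + 1) := fun m => by
    by_cases h : Even m <;> simp [a, h, Nat.even_add_one]
  have hc : ∀ n : ℕ, ((List.range n).map a).IsChain (· ≠ ·) := fun n => by
    rw [List.isChain_map]
    exact (List.isChain_range _ n).2 fun m _ => ha m
  let f : Fin R → TreeGroup d R := fun m =>
    (((List.range m).map a).map (treeGen d R)).prod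
  have hf : Function.Injective f := fun m n h => by
    have := congrArg List.length ((freeUpTo_treeGen d R).inj _ _ (hc m) (hc n)
      (by simp) (by simp) h)
    exact Fin.ext (by simpa using this)
  simpa using Nat.card_le_card_of_injective f hf

end TreeBall

/-! ### Round elimination -/

section SpeedUp

variable {Γ Ω : Type*}

lemma dependsOn_indicator {S : Set Γ} {E : Set (Γ → Ω)} (hE : DependsOn (· ∈ E) S) :
    DependsOn (E.indicator (1 : (Γ → Ω) → ℝ≥0∞)) S := fun x y h => by
  have : x ∈ E ↔ y ∈ E := iff_of_eq (hE h)
  by_cases hx : x ∈ E <;> simp [Set.indicator, ← this, hx]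

variable [Group Γ]

/-- The labelling `x` as seen from the element `g`. -/
def viewFrom (g : Γ) (x : Γ → Ω) : Γ → Ω := fun h => x (g * h)

lemma dependsOn_comp_viewFrom {β : Type*} {f : (Γ → Ω) → β} {S : Set Γ} (hf : DependsOn f S)
    (g : Γ) : DependsOn (fun x => f (viewFrom g x)) {h | g⁻¹ * h ∈ S} :=
  fun _ _ hxy => hf fun h hh => hxy (g * h) (by simpa using hh)

variable [Fintype Γ] [MeasurableSpace Ω] {d : ℕ} {s : Fin d → Γ} {R t : ℕ}
variable (μ : Measure Ω) [IsProbabilityMeasure μ]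

lemma measurePreserving_viewFrom (g : Γ) :
    MeasurePreserving (viewFrom (Ω := Ω) g) (Measure.pi fun _ => μ) (Measure.pi fun _ => μ) :=
  measurePreserving_comp_equiv μ (Equiv.mulLeft g)

lemma measure_preimage_viewFrom (g : Γ) {E : Set (Γ → Ω)} (hE : MeasurableSet E) :
    (Measure.pi fun _ => μ) (viewFrom g ⁻¹' E) = (Measure.pi fun _ => μ) E :=
  (measurePreserving_viewFrom μ g).measure_preimage hE.nullMeasurableSet

/-- Conditional independence of an event as seen from the two ends of an edge. -/
lemma FreeUpTo.condMean_inter_viewFrom (hs : FreeUpTo s R) (i : Fin d) {S B : Set Γ}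
    {E : Set (Γ → Ω)} (hE : MeasurableSet E) (hEB : DependsOn (· ∈ E) B)
    (hS : ∀ g, s i * g ∈ S ↔ g ∈ S) (hB : ∀ g, g ∈ B → s i * g ∈ B → g ∈ S) (x : Γ → Ω) :
    condMean μ S ((E ∩ viewFrom (s i) ⁻¹' E).indicator 1) x =
      condMean μ S (E.indicator 1) x * condMean μ S (E.indicator 1) (viewFrom (s i) x) := by
  have hEm : Measurable (E.indicator (1 : (Γ → Ω) → ℝ≥0∞)) := measurable_one.indicator hE
  have h1 : (E ∩ viewFrom (s i) ⁻¹' E).indicator (1 : (Γ → Ω) → ℝ≥0∞) =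
      fun x => E.indicator 1 x * E.indicator 1 (viewFrom (s i) x) := by
    rw [Set.inter_indicator_one]; rfl
  have hinv : (s i)⁻¹ = s i := inv_eq_of_mul_eq_one_left (hs.mul_self i)
  rw [h1, condMean_mul μ (χ := fun x => E.indicator 1 (viewFrom (s i) x)) hEm
    (hEm.comp (measurePreserving_viewFrom μ (s i)).measurable)
    (dependsOn_indicator hEB) (dependsOn_comp_viewFrom (dependsOn_indicator hEB) (s i))]
  · exact congrArg _ (condMean_comp_equiv μ (Equiv.mulLeft (s i)) hS hEm x)
  · rintro g ⟨h1, h2⟩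
    exact hB g h1 (by simpa [hinv] using h2)

/-- From a colouring to half-edge orientations, with the views of edges. -/
lemma FreeUpTo.exists_orientation (hs : FreeUpTo s R) (ht : t + 2 ≤ R)
    {f : (Γ → Ω) → Fin d} (hf : Measurable f) (hft : DependsOn f (wordBall s (t + 1)))
    {p L : ℝ≥0∞}
    (hp : ∀ i, (Measure.pi fun _ => μ) {x | f x = i ∧ f (viewFrom (s i) x) = i} ≤ p) :
    ∃ o : Fin d → Set (Γ → Ω), (∀ i, MeasurableSet (o i)) ∧
      (∀ i, DependsOn (· ∈ o i) {g | g ∈ wordBall s t ∨ s i * g ∈ wordBall s t}) ∧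
      (∀ i, L * L * (Measure.pi fun _ => μ) (o i ∩ viewFrom (s i) ⁻¹' o i) ≤ p) ∧
      (Measure.pi fun _ => μ) (⋂ i, (o i)ᶜ) ≤ d * L := by
  let S : Fin d → Set Γ := fun i => {g | g ∈ wordBall s t ∨ s i * g ∈ wordBall s t}
  let E : Fin d → Set (Γ → Ω) := fun i => f ⁻¹' {i}
  have hE : ∀ i, MeasurableSet (E i) := fun i => hf (measurableSet_singleton i)
  have hEm : ∀ i, Measurable ((E i).indicator (1 : (Γ → Ω) → ℝ≥0∞)) :=
    fun i => measurable_one.indicator (hE i)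
  have hP : ∀ i, Measurable (condMean μ (S i) ((E i).indicator 1)) :=
    fun i => measurable_condMean μ (hEm i)
  -- The edge of colour `i` is directed outwards when, given the `t`-balls of its two ends, the node
  -- has colour `i` with probability at least `L`.
  refine ⟨fun i => {x | L ≤ condMean μ (S i) ((E i).indicator 1) x},
    fun i => measurableSet_le measurable_const (hP i), fun i x y h => ?_, fun i => ?_, ?_⟩
  · change (L ≤ _) = (L ≤ _)
    rw [condMean_dependsOn μ (S i) _ h]
  · have hEB : DependsOn (· ∈ E i) (wordBall s (t + 1)) := fun x y h => by
      change (f x = i) = (f y = i)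
      rw [hft h]
    have key := hs.condMean_inter_viewFrom μ i (S := S i) (hE i) hEB
      (fun g => by simp only [S, Set.mem_ofPred_eq, hs.mul_cancel_left]; exact or_comm)
      (fun g => hs.mem_wordBall_of_mul_mem ht)
    have hI : MeasurableSet (E i ∩ viewFrom (s i) ⁻¹' E i) :=
      (hE i).inter ((measurePreserving_viewFrom μ (s i)).measurable (hE i))
    have hIm : Measurable ((E i ∩ viewFrom (s i) ⁻¹' E i).indicator (1 : (Γ → Ω) → ℝ≥0∞)) :=
      measurable_one.indicator hI
    refine le_trans ?_ (hp i)
    -- If both ends direct the edge outwards, both have colour `i` with conditional probability at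
    -- least `L * L`; Markov's inequality concludes.
    calc _ ≤ L * L * (Measure.pi fun _ => μ)
          {x | L * L ≤ condMean μ (S i) ((E i ∩ viewFrom (s i) ⁻¹' E i).indicator 1) x} := by
          gcongr
          rintro x ⟨h1, h2⟩
          change L * L ≤ _
          rw [key x]
          exact mul_le_mul' h1 h2
      _ ≤ _ := mul_meas_ge_le_lintegral (measurable_condMean μ hIm) _
      _ = _ := by rw [lintegral_condMean μ _ hIm, lintegral_indicator_one hI]; rfl
  · calc _ ≤ (Measure.pi fun _ => μ)
          (⋃ i, (E i ∩ {x | condMean μ (S i) ((E i).indicator 1) x ≤ L})) := by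
          refine measure_mono fun x hx => Set.mem_iUnion.2 ⟨f x, rfl, ?_⟩
          have : ¬ L ≤ condMean μ (S (f x)) ((E (f x)).indicator 1) x :=
            Set.mem_iInter.1 hx (f x)
          exact le_of_not_ge this
      _ ≤ ∑ i : Fin d, (Measure.pi fun _ => μ)
          (E i ∩ {x | condMean μ (S i) ((E i).indicator 1) x ≤ L}) := measure_iUnion_fintype_le _ _
      _ ≤ ∑ _ : Fin d, L := Finset.sum_le_sum fun i _ => measure_condMean_le μ (hE i) L
      _ = d * L := by simp

/-- From half-edge orientations with the views of edges back to a colouring with the views of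
nodes. -/
lemma FreeUpTo.exists_colouring (hs : FreeUpTo s R) (hd : 0 < d) (ht : t + 1 ≤ R)
    {o : Fin d → Set (Γ → Ω)} (ho : ∀ i, MeasurableSet (o i))
    (hot : ∀ i, DependsOn (· ∈ o i) {g | g ∈ wordBall s t ∨ s i * g ∈ wordBall s t})
    {p q r δ : ℝ≥0∞} (hp : ∀ i, (Measure.pi fun _ => μ) (o i ∩ viewFrom (s i) ⁻¹' o i) ≤ p)
    (hq : (Measure.pi fun _ => μ) (⋂ i, (o i)ᶜ) ≤ q) (hr : ∀ a, δ ^ d * a ≤ q → a ≤ r) :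
    ∃ f : (Γ → Ω) → Fin d, Measurable f ∧ DependsOn f (wordBall s t) ∧
      ∀ i, (Measure.pi fun _ => μ) {x | f x = i ∧ f (viewFrom (s i) x) = i} ≤
        p + 2 * δ + 2 * r := by
  classical
  let B := wordBall s t
  have hm : ∀ i, Measurable ((o i)ᶜ.indicator (1 : (Γ → Ω) → ℝ≥0∞)) :=
    fun i => measurable_one.indicator (ho i).compl
  let Q : Fin d → (Γ → Ω) → ℝ≥0∞ := fun i => condMean μ B ((o i)ᶜ.indicator 1)
  have hQ : ∀ i, Measurable (Q i) := fun i => measurable_condMean μ (hm i)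
  let D : Fin d → Set (Γ → Ω) := fun i => {x | Q i x ≤ δ}
  -- The node takes a colour whose edge, given its view, fails to be outgoing with probability at
  -- most `δ`. The default is used only on `N`, which is counted as failure.
  let F : Set (Fin d) → Fin d := fun I => if h : I.Nonempty then h.some else ⟨0, hd⟩
  let f : (Γ → Ω) → Fin d := fun x => F {i | x ∈ D i}
  have hD : ∀ i, MeasurableSet (D i) := fun i => measurableSet_le (hQ i) measurable_const
  let N : Set (Γ → Ω) := ⋂ i, (D i)ᶜ
  have hN : MeasurableSet N := MeasurableSet.iInter fun i => (hD i).compl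
  have hNr : (Measure.pi fun _ => μ) N ≤ r := by
    refine hr _ (le_trans ?_ hq)
    -- Given the view of the node, its half-edges are independent, so on `N` a sink has conditional
    -- probability at least `δ ^ d`.
    have hprod : condMean μ B (fun x => ∏ i, (o i)ᶜ.indicator 1 x) = fun x => ∏ i, Q i x := by
      refine condMean_prod μ Finset.univ hm (A := fun i => {g | g ∈ B ∨ s i * g ∈ B})
        (fun i => dependsOn_indicator fun x y h => ?_) ?_
      · exact congrArg Not (hot i h)
      · rintro i j hij g ⟨h1 | h1, h2 | h2⟩
        · exact h1
        · exact h1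
        · exact h2
        · exact hs.mem_wordBall_of_ne ht hij h1 h2
    have hi : (fun x => ∏ i, (o i)ᶜ.indicator (1 : (Γ → Ω) → ℝ≥0∞) x) =
        (⋂ i, (o i)ᶜ).indicator 1 := by
      funext x
      by_cases hx : x ∈ ⋂ i, (o i)ᶜ
      · rw [Set.indicator_of_mem hx]
        exact Finset.prod_eq_one fun i _ => Set.indicator_of_mem (Set.mem_iInter.1 hx i) _
      · rw [Set.indicator_of_notMem hx]
        obtain ⟨i, hi⟩ := not_forall.1 (fun h => hx (Set.mem_iInter.2 h))
        exact Finset.prod_eq_zero (Finset.mem_univ i) (Set.indicator_of_notMem hi _)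
    calc δ ^ d * (Measure.pi fun _ => μ) N
        ≤ δ ^ d * (Measure.pi fun _ => μ) {x | δ ^ d ≤ ∏ i, Q i x} := by
          gcongr
          intro x hx
          calc δ ^ d = ∏ _ : Fin d, δ := by simp
            _ ≤ _ := Finset.prod_le_prod' fun i _ => le_of_not_ge (Set.mem_iInter.1 hx i)
      _ ≤ ∫⁻ x, ∏ i, Q i x ∂(Measure.pi fun _ => μ) :=
          mul_meas_ge_le_lintegral (Finset.measurable_prod _ fun i _ => hQ i) _
      _ = (Measure.pi fun _ => μ) (⋂ i, (o i)ᶜ) := by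
          have := lintegral_condMean μ B (Finset.measurable_prod Finset.univ fun i _ => hm i)
          rw [hprod, hi, lintegral_indicator_one (MeasurableSet.iInter fun i => (ho i).compl)]
            at this
          exact this
  have hfind : ∀ x, x ∉ N → x ∈ D (f x) := fun x hx => by
    have h : {i | x ∈ D i}.Nonempty := by
      by_contra h
      exact hx (Set.mem_iInter.2 fun i hi => h ⟨i, hi⟩)
    simp only [f, F, dif_pos h]
    exact h.some_mem
  refine ⟨f, ?_, fun x y h => ?_, fun i => ?_⟩
  · refine (Measurable.of_discrete (f := F)).comp ?_
    exact measurable_set_iff.2 fun i => measurable_mem.2 (hD i)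
  · have : ∀ i, Q i x = Q i y := fun i => condMean_dependsOn μ B _ h
    have hxy : {i | x ∈ D i} = {i | y ∈ D i} := Set.ext fun i => by
      change Q i x ≤ δ ↔ Q i y ≤ δ
      rw [this]
    exact congrArg F hxy
  · have hv := (measurePreserving_viewFrom (Γ := Γ) μ (s i)).measurable
    let U : Set (Γ → Ω) := (o i)ᶜ ∩ D i
    have hU : (Measure.pi fun _ => μ) U ≤ δ := measure_condMean_le μ (ho i).compl δ
    have hUm : MeasurableSet U := (ho i).compl.inter (hD i)
    have hsub : {x | f x = i ∧ f (viewFrom (s i) x) = i} ⊆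
        (o i ∩ viewFrom (s i) ⁻¹' o i) ∪ (U ∪ viewFrom (s i) ⁻¹' U) ∪
          (N ∪ viewFrom (s i) ⁻¹' N) := by
      rintro x ⟨h1, h2⟩
      by_cases hx : x ∈ N
      · exact .inr (.inl hx)
      by_cases hx' : viewFrom (s i) x ∈ N
      · exact .inr (.inr hx')
      have e1 := hfind x hx
      have e2 := hfind _ hx'
      rw [h1] at e1
      rw [h2] at e2
      by_cases hi : x ∈ o i
      · by_cases hi' : viewFrom (s i) x ∈ o i
        · exact .inl (.inl ⟨hi, hi'⟩)
        · exact .inl (.inr (.inr ⟨hi', e2⟩))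
      · exact .inl (.inr (.inl ⟨hi, e1⟩))
    refine (measure_mono hsub).trans ((measure_union_le _ _).trans (add_le_add
      ((measure_union_le _ _).trans (add_le_add (hp i) ?_)) ?_))
    · refine (measure_union_le _ _).trans ?_
      rw [measure_preimage_viewFrom μ _ hUm, two_mul]
      exact add_le_add hU hU
    · refine (measure_union_le _ _).trans ?_
      rw [measure_preimage_viewFrom μ _ hN, two_mul]
      exact add_le_add hNr hNr

/-- The thresholds are `L = y ^ (d + 1)` and `δ = y`. Inconsistent edges then have probability at
most `y ^ (d + 1) ≤ y`, and `δ ^ d * a ≤ d * L` gives `r = d * y`; the total is `y + 2 * y + 2 * d *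
y`. -/
lemma FreeUpTo.speedUp (hs : FreeUpTo s R) (hd : 0 < d) (ht : t + 2 ≤ R)
    {f : (Γ → Ω) → Fin d} (hf : Measurable f) (hft : DependsOn f (wordBall s (t + 1)))
    {y : ℝ≥0∞} (hy0 : y ≠ 0) (hy1 : y ≤ 1)
    (hp : ∀ i, (Measure.pi fun _ => μ) {x | f x = i ∧ f (viewFrom (s i) x) = i} ≤
      y ^ (3 * (d + 1))) :
    ∃ f' : (Γ → Ω) → Fin d, Measurable f' ∧ DependsOn f' (wordBall s t) ∧
      ∀ i, (Measure.pi fun _ => μ) {x | f' x = i ∧ f' (viewFrom (s i) x) = i} ≤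
        (2 * d + 3) * y := by
  have hpow : ∀ m, y ^ m ≠ 0 ∧ y ^ m ≠ ⊤ := fun m =>
    ⟨pow_ne_zero m hy0, ENNReal.pow_ne_top (ne_top_of_le_ne_top ENNReal.one_ne_top hy1)⟩
  obtain ⟨o, ho, hot, h1, h2⟩ := hs.exists_orientation μ ht hf hft (L := y ^ (d + 1)) hp
  have h1' : ∀ i, (Measure.pi fun _ => μ) (o i ∩ viewFrom (s i) ⁻¹' o i) ≤ y := fun i => by
    have := h1 i
    rw [show 3 * (d + 1) = (d + 1) + (d + 1) + (d + 1) by ring, pow_add _ (d + 1 + (d + 1)),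
      ← pow_add, ENNReal.mul_le_mul_iff_right (hpow _).1 (hpow _).2] at this
    exact this.trans (pow_le_of_le_one zero_le hy1 (by omega))
  have hr : ∀ a, y ^ d * a ≤ d * y ^ (d + 1) → a ≤ d * y := fun a ha => by
    rwa [show (d : ℝ≥0∞) * y ^ (d + 1) = y ^ d * (d * y) by ring,
      ENNReal.mul_le_mul_iff_right (hpow _).1 (hpow _).2] at ha
  obtain ⟨f', hf', hft', h⟩ := hs.exists_colouring μ hd (t := t) (by omega) ho hot h1' h2 hr
  exact ⟨f', hf', hft', fun i => (h i).trans (le_of_eq (by ring))⟩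

/-- A colouring with the views of radius `t` has an edge that is monochromatic, in its own colour,
with at least a doubly exponentially small probability. -/
lemma FreeUpTo.exists_lt_measure (hs : FreeUpTo s R) (hd : 0 < d) (ht : t + 1 ≤ R)
    {f : (Γ → Ω) → Fin d} (hf : Measurable f) (hft : DependsOn f (wordBall s t)) :
    ∃ i, (((2 * d + 3 : ℝ≥0∞) ^ 2)⁻¹) ^ ((6 * (d + 1)) ^ t) <
      (Measure.pi fun _ => μ) {x | f x = i ∧ f (viewFrom (s i) x) = i} := by
  set M : ℝ≥0∞ := 2 * d + 3 with hM
  have hM1 : 1 ≤ M := le_add_left (by norm_num)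
  have hMt : M ≠ ⊤ := by simp [hM, ENNReal.mul_eq_top]
  have hM0 : M ≠ 0 := by simp [hM]
  have hε : (M ^ 2)⁻¹ ≤ 1 := ENNReal.inv_le_one.2 (one_le_pow₀ hM1)
  have hε0 : (M ^ 2)⁻¹ ≠ 0 := ENNReal.inv_ne_zero.2 (ENNReal.pow_ne_top hMt)
  induction t generalizing f with
  | zero =>
    by_contra! hp
    have hle : ∀ i, (Measure.pi fun _ => μ) (f ⁻¹' {i}) ≤ M⁻¹ := fun i => by
      have hE : MeasurableSet (f ⁻¹' {i}) := hf (measurableSet_singleton i)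
      have hEB : DependsOn (· ∈ f ⁻¹' {i}) {(1 : Γ)} := fun x y h => by
        change (f x = i) = (f y = i)
        rw [hft (wordBall_zero (s := s) ▸ h)]
      have hI : MeasurableSet (f ⁻¹' {i} ∩ viewFrom (s i) ⁻¹' (f ⁻¹' {i})) :=
        hE.inter ((measurePreserving_viewFrom μ (s i)).measurable hE)
      obtain ⟨x⟩ := (Measure.pi fun _ : Γ => μ).nonempty_of_neZero
      -- With views of radius `0` the two ends use different labels; conditioning on nothing gives
      -- plain independence.
      have := hs.condMean_inter_viewFrom μ i (S := ∅) hE hEB (by simp)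
        (by rintro _ rfl h; exact hs.ne_one ht i (by simpa using h)) x
      simp only [condMean_empty, lintegral_indicator_one hI, lintegral_indicator_one hE] at this
      have h2 := hp i
      rw [pow_zero, pow_one] at h2
      have h3 := this.symm.trans_le h2
      rw [← sq, ENNReal.inv_pow] at h3
      exact (ENNReal.pow_right_strictMono two_ne_zero).le_iff_le.1 h3
    have hsum : (1 : ℝ≥0∞) ≤ d * M⁻¹ := by
      calc (1 : ℝ≥0∞) = (Measure.pi fun _ => μ) (⋃ i, f ⁻¹' {i}) := by
            rw [← Set.preimage_iUnion, Set.iUnion_of_singleton, Set.preimage_univ, measure_univ]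
        _ ≤ ∑ i : Fin d, (Measure.pi fun _ => μ) (f ⁻¹' {i}) := measure_iUnion_fintype_le _ _
        _ ≤ ∑ _ : Fin d, M⁻¹ := Finset.sum_le_sum fun i _ => hle i
        _ = d * M⁻¹ := by simp
    rw [← div_eq_mul_inv, ENNReal.le_div_iff_mul_le (.inl hM0) (.inl hMt), one_mul, hM] at hsum
    have : 2 * d + 3 ≤ d := by exact_mod_cast hsum
    omega
  | succ t ih =>
    by_contra! hp
    set k := (6 * (d + 1)) ^ t with hk
    have hk0 : k ≠ 0 := by positivity
    -- The factor `6 = 2 * 3` in the base leaves `y` with exponent `2 * k`: one power `k` absorbs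
    -- the constant `M`, the other is the bound for radius `t`.
    obtain ⟨f', hf', hft', h⟩ := hs.speedUp μ hd ht hf hft (y := (M ^ 2)⁻¹ ^ (2 * k))
      (pow_ne_zero _ hε0) (pow_le_one₀ zero_le hε) (fun i => (hp i).trans (le_of_eq (by
        rw [← pow_mul, hk]; congr 1; ring)))
    obtain ⟨i, hi⟩ := ih (by omega) hf' hft'
    refine (hi.trans_le (h i)).not_ge ?_
    calc M * (M ^ 2)⁻¹ ^ (2 * k) = (M * (M ^ 2)⁻¹ ^ k) * (M ^ 2)⁻¹ ^ k := by ring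
      _ ≤ 1 * (M ^ 2)⁻¹ ^ k := by
        gcongr
        calc M * (M ^ 2)⁻¹ ^ k ≤ M * (M ^ 2)⁻¹ := by
              gcongr
              exact pow_le_of_le_one zero_le hε hk0
          _ ≤ M * M⁻¹ := by
              gcongr
              exact le_self_pow₀ hM1 two_ne_zero
          _ = 1 := ENNReal.mul_inv_cancel hM0 hMt
      _ = (M ^ 2)⁻¹ ^ k := one_mul _

end SpeedUp

/-! ### The Cayley graph as an edge-coloured network -/

section CayleyGraph

variable {Γ : Type} [Group Γ] {d : ℕ} {s : Fin d → Γ} {R : ℕ}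

namespace FreeUpTo

/-- The Cayley graph of the involutions `s`. -/
def cayleyGraph (hs : FreeUpTo s R) (hR : 1 ≤ R) : SimpleGraph Γ where
  Adj g h := ∃ i, h = g * s i
  symm.symm g h := by
    rintro ⟨i, rfl⟩
    exact ⟨i, (hs.mul_cancel_right i g).symm⟩
  loopless.irrefl g := by
    rintro ⟨i, h⟩
    exact hs.ne_one hR i (left_eq_mul.1 h)

variable (hs : FreeUpTo s R) (hR : 1 ≤ R)

/-- The generator is the same from either end because it is an involution, so it can serve as the
colour of the edge. -/
lemma exists_eq_of_mem_edge (e : (hs.cayleyGraph hR).edgeSet) :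
    ∃ i, ∀ g ∈ e.1, e.1 = s(g, g * s i) := by
  obtain ⟨e, he⟩ := e
  induction e with
  | _ a b =>
    obtain ⟨i, hi⟩ : ∃ i, b = a * s i := he
    refine ⟨i, fun g hg => ?_⟩
    obtain rfl | rfl := Sym2.mem_iff.1 hg
    · exact congrArg (fun c => s(g, c)) hi
    · have : a = g * s i := by rw [hi, hs.mul_cancel_right]
      rw [← this]
      exact Sym2.eq_swap

/-- The colouring of the edges of the Cayley graph by the generators. -/
noncomputable def cayleyColouring : EdgeColouring (hs.cayleyGraph hR) d :=
  SimpleGraph.Coloring.mk (fun e => (hs.exists_eq_of_mem_edge hR e).choose) fun {e e'} h heq => by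
    obtain ⟨hne, g, hg, hg'⟩ := SimpleGraph.lineGraph_adj_iff_exists.1 h
    refine hne (Subtype.ext ?_)
    rw [(hs.exists_eq_of_mem_edge hR e).choose_spec g hg,
      (hs.exists_eq_of_mem_edge hR e').choose_spec g hg', heq]

lemma eq_mul_colour {a b : Γ} (h : (hs.cayleyGraph hR).Adj a b) :
    b = a * s ((hs.cayleyColouring hR).colour h) := by
  have := (hs.exists_eq_of_mem_edge hR ⟨s(a, b), h⟩).choose_spec a (by simp)
  exact Sym2.congr_right.1 this

lemma cayleyGraph_adj (a : Γ) (i : Fin d) : (hs.cayleyGraph hR).Adj a (a * s i) := ⟨i, rfl⟩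

lemma colour_cayleyColouring {a b : Γ} (h : (hs.cayleyGraph hR).Adj a b) {i : Fin d}
    (hb : b = a * s i) : (hs.cayleyColouring hR).colour h = i := by
  refine hs.injective hR (mul_left_cancel (a := a) ?_)
  rw [← hs.eq_mul_colour hR h, hb]

lemma coloursAt_cayleyColouring (a : Γ) : (hs.cayleyColouring hR).coloursAt a = Set.univ :=
  Set.eq_univ_of_forall fun i =>
    ⟨a * s i, hs.cayleyGraph_adj hR a i, (hs.colour_cayleyColouring hR _ rfl).symm⟩

lemma connected_cayleyGraph (hgen : Subgroup.closure (Set.range s) = ⊤) :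
    (hs.cayleyGraph hR).Connected := by
  have key : ∀ g a : Γ, (hs.cayleyGraph hR).Reachable a (a * g) := fun g => by
    have hg : g ∈ Subgroup.closure (Set.range s) := hgen ▸ Subgroup.mem_top g
    induction hg using Subgroup.closure_induction with
    | mem g hg =>
      obtain ⟨i, rfl⟩ := hg
      exact fun a => (hs.cayleyGraph_adj hR a i).reachable
    | one => intro a; rw [mul_one]
    | mul g h _ _ h1 h2 => intro a; rw [← mul_assoc]; exact (h1 a).trans (h2 _)
    | inv g _ h => intro a; simpa using (h (a * g⁻¹)).symm
  exact (SimpleGraph.connected_iff _).2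
    ⟨fun a b => by simpa using key (a⁻¹ * b) a, ⟨1⟩⟩

lemma isRegularOfDegree_cayleyGraph [Fintype Γ] [DecidableRel (hs.cayleyGraph hR).Adj] :
    (hs.cayleyGraph hR).IsRegularOfDegree d := fun a => by
  classical
  have : (hs.cayleyGraph hR).neighborFinset a = Finset.univ.image fun i => a * s i := by
    ext b
    simp only [SimpleGraph.mem_neighborFinset, Finset.mem_image, Finset.mem_univ, true_and]
    exact exists_congr fun i => eq_comm
  rw [← SimpleGraph.card_neighborFinset_eq_degree, this, Finset.card_image_of_injective,
    Finset.card_fin]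
  exact (mul_right_injective a).comp (hs.injective hR)

end FreeUpTo

end CayleyGraph

/-! ### Algorithms as functions of the local view -/

section Simulation

variable {Γ : Type} [Group Γ] [Fintype Γ] {d : ℕ} {s : Fin d → Γ} {R : ℕ} (hs : FreeUpTo s R)
  (hR : 1 ≤ R) [DecidableRel (hs.cayleyGraph hR).Adj]

/-- In a Cayley graph the state of a node after `t` rounds is determined by the random numbers of
the nodes at distance at most `t`. -/
lemma FreeUpTo.stateAfter_eq {Out : Type w} (A : LocalAlgorithm.{u, v, w} d Out)
    {x y : Γ → unitInterval} (t : ℕ) {a b : Γ} (h : ∀ g ∈ wordBall s t, x (a * g) = y (b * g)) :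
    A.stateAfter (hs.cayleyGraph hR) (hs.cayleyColouring hR) x t a =
      A.stateAfter (hs.cayleyGraph hR) (hs.cayleyColouring hR) y t b := by
  induction t generalizing a b with
  | zero =>
    have := h 1 (one_mem_wordBall 0)
    simp only [mul_one] at this
    simp only [LocalAlgorithm.stateAfter, this, hs.coloursAt_cayleyColouring hR]
  | succ t ih =>
    -- Indexed by colour instead of by neighbour, the incoming messages have the same form at every
    -- node.
    have key : ∀ (z : Γ → unitInterval) (c : Γ),
        {m | ∃ (e : Γ) (h : (hs.cayleyGraph hR).Adj c e), m = ((hs.cayleyColouring hR).colour h,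
          A.send (A.stateAfter (hs.cayleyGraph hR) (hs.cayleyColouring hR) z t e)
            ((hs.cayleyColouring hR).colour h))} =
        {m | ∃ i, m = (i, A.send (A.stateAfter (hs.cayleyGraph hR) (hs.cayleyColouring hR) z t
          (c * s i)) i)} := fun z c => by
      ext m
      constructor
      · rintro ⟨e, he, hm⟩
        refine ⟨(hs.cayleyColouring hR).colour he, ?_⟩
        rw [← hs.eq_mul_colour hR he]
        exact hm
      · rintro ⟨i, hm⟩
        refine ⟨c * s i, hs.cayleyGraph_adj hR c i, ?_⟩
        rw [hs.colour_cayleyColouring hR _ rfl]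
        exact hm
    have h1 := ih fun g hg => h g (wordBall_mono t.le_succ hg)
    have h2 : ∀ i, _ := fun i => ih (a := a * s i) (b := b * s i) fun g hg => by
      simpa [mul_assoc] using h (s i * g) (hs.mul_mem_wordBall hg i)
    simp only [LocalAlgorithm.stateAfter, key, h1, h2]

/-- A colour of an edge that is directed outwards. -/
noncomputable def outColour (hd : 0 < d) (o : Fin d → Bool) : Fin d :=
  open Classical in if h : ∃ i, o i = true then h.choose else ⟨0, hd⟩

lemma outColour_spec (hd : 0 < d) {o : Fin d → Bool} (h : ∃ i, o i = true) :
    o (outColour hd o) = true := by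
  rw [outColour, dif_pos h]
  exact h.choose_spec

lemma IsSinklessOutput.exists_eq_true {V : Type} {G : SimpleGraph V} {ψ : EdgeColouring G d}
    {o : V → Fin d → Bool} (h : IsSinklessOutput G ψ o) (a : V) : ∃ i, o a i = true := by
  obtain ⟨σ, hσ, ho⟩ := h
  obtain ⟨b, hb⟩ := Set.nonempty_of_ncard_ne_zero (hσ a).ne'
  exact ⟨_, (ho a b (σ.adj_of_dir hb)).2 hb⟩

lemma IsSinklessOutput.not_both {V : Type} {G : SimpleGraph V} {ψ : EdgeColouring G d}
    {o : V → Fin d → Bool} (h : IsSinklessOutput G ψ o) {a b : V} (hab : G.Adj a b) {i : Fin d}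
    (hi : ψ.colour hab = i) (ha : o a i = true) (hb : o b i = true) : False := by
  obtain ⟨σ, -, ho⟩ := h
  have hi' : ψ.colour hab.symm = i := by
    rw [← hi]
    exact congrArg ψ (Subtype.ext Sym2.eq_swap)
  have h1 := (ho a b hab).1 (hi ▸ ha)
  exact (σ.dir_iff_not_dir hab).1 h1 ((ho b a hab.symm).1 (hi' ▸ hb))

/-- On a Cayley graph that looks like a tree up to distance `t`, every algorithm with `t` rounds
fails with at least a doubly exponentially small probability. -/
lemma FreeUpTo.measure_isSinklessOutput_lt (hd : 0 < d) {t : ℕ} (ht : t + 1 ≤ R)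
    (A : LocalAlgorithm.{u, v} d (Fin d → Bool))
    (hA : ∀ a : Γ, Measurable fun x : Γ → unitInterval =>
      A.outputAfter (hs.cayleyGraph hR) (hs.cayleyColouring hR) t x a) :
    (volume : Measure (Γ → unitInterval)).real {x | IsSinklessOutput (hs.cayleyGraph hR)
      (hs.cayleyColouring hR) (A.outputAfter (hs.cayleyGraph hR) (hs.cayleyColouring hR) t x)} <
      1 - (((2 * d + 3 : ℝ) ^ 2)⁻¹) ^ ((6 * (d + 1)) ^ t) := by
  -- Colour by a chosen outgoing edge; by homogeneity the choice at `s i` is `f` of the view from `s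
  -- i`.
  let f : (Γ → unitInterval) → Fin d := fun x =>
    outColour hd (A.outputAfter (hs.cayleyGraph hR) (hs.cayleyColouring hR) t x 1)
  have hf : Measurable f := (Measurable.of_discrete (f := outColour hd)).comp (hA 1)
  have hft : DependsOn f (wordBall s t) := fun x y h => by
    simp only [f, LocalAlgorithm.outputAfter]
    rw [hs.stateAfter_eq hR A t (a := 1) (b := 1) (x := x) (y := y)]
    simpa using h
  have hv : ∀ i x, f (viewFrom (s i) x) = outColour hd
      (A.outputAfter (hs.cayleyGraph hR) (hs.cayleyColouring hR) t x (s i)) := fun i x => by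
    simp only [f, LocalAlgorithm.outputAfter]
    rw [hs.stateAfter_eq hR A t (a := 1) (b := s i) (x := viewFrom (s i) x) (y := x)]
    simp [viewFrom]
  obtain ⟨i, hi⟩ := hs.exists_lt_measure volume hd ht hf hft
  set E : Set (Γ → unitInterval) := {x | f x = i ∧ f (viewFrom (s i) x) = i} with hE
  have hEm : MeasurableSet E := (hf (measurableSet_singleton i)).inter
    ((measurePreserving_viewFrom volume (s i)).measurable (hf (measurableSet_singleton i)))
  have hsub : {x | IsSinklessOutput (hs.cayleyGraph hR) (hs.cayleyColouring hR)
      (A.outputAfter (hs.cayleyGraph hR) (hs.cayleyColouring hR) t x)} ⊆ Eᶜ := by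
    rintro x hx ⟨h1, h2⟩
    have hx' : IsSinklessOutput _ _ _ := hx
    have e1 := outColour_spec hd (hx'.exists_eq_true 1)
    have e2 := outColour_spec hd (hx'.exists_eq_true (s i))
    rw [hv i] at h2
    rw [h2] at e2
    change outColour hd _ = i at h1
    rw [h1] at e1
    have hadj : (hs.cayleyGraph hR).Adj 1 (s i) := ⟨i, by simp⟩
    exact hx'.not_both hadj (hs.colour_cayleyColouring hR hadj (by simp)) e1 e2
  have hlt : (((2 * d + 3 : ℝ) ^ 2)⁻¹) ^ ((6 * (d + 1)) ^ t) <
      (volume : Measure (Γ → unitInterval)).real E := by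
    have := ENNReal.toReal_strict_mono (measure_ne_top _ _) hi
    simpa [ENNReal.toReal_add, ENNReal.mul_eq_top, measureReal_def, volume_pi] using this
  calc _ ≤ (volume : Measure (Γ → unitInterval)).real Eᶜ := measureReal_mono hsub
    _ = 1 - (volume : Measure (Γ → unitInterval)).real E := probReal_compl_eq_one_sub hEm
    _ < _ := by linarith

end Simulation

/-! ### Comparing `T n` with the size of the network -/

section Asymptotics

/-- The growth estimates for graphs with `n` nodes that look like trees up to distance `R`. -/
lemma eventually_of_isLittleO {T : ℕ → ℕ} {c M : ℝ} {D K : ℕ} (hc : 0 < c) (hM : 1 ≤ M)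
    (hD : 2 ≤ D) (hK : D ≤ K)
    (hT : (fun n : ℕ => (T n : ℝ)) =o[atTop] fun n : ℕ => Real.log (Real.log (n : ℝ))) :
    ∀ᶠ n : ℕ in atTop, ∀ R, 2 ≤ R → n ≤ (D ^ R).factorial →
      T n + 1 ≤ R ∧ 1 / (n : ℝ) ^ c ≤ M⁻¹ ^ (K ^ T n) := by
  have hKpos : 0 < Real.log K := Real.log_pos (by exact_mod_cast (by omega : 1 < K))
  have hlog : Tendsto (fun n : ℕ => Real.log (n : ℝ)) atTop atTop :=
    Real.tendsto_log_atTop.comp tendsto_natCast_atTop_atTop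
  -- This constant makes `K ^ T n` at most `(log n) ^ (1 / 4)`, which serves both claims.
  have hη : 0 < 1 / (4 * Real.log K) := by positivity
  filter_upwards [hT.bound hη, hlog.eventually_ge_atTop 1,
    hlog.eventually_ge_atTop ((Real.log M / c) ^ 2), eventually_ge_atTop 1]
    with n h1 h2 h3 h4 R hR hn
  have hn0 : (0 : ℝ) < n := by exact_mod_cast h4
  have hu : 0 ≤ Real.log (Real.log n) := Real.log_nonneg h2
  simp only [Real.norm_eq_abs, Nat.abs_cast, abs_of_nonneg hu] at h1
  have hTK : (T n : ℝ) * Real.log K ≤ Real.log (Real.log n) / 4 := by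
    calc (T n : ℝ) * Real.log K ≤ 1 / (4 * Real.log K) * Real.log (Real.log n) * Real.log K := by
          gcongr
      _ = _ := by field_simp
  constructor
  · have hDR : (1 : ℝ) ≤ (D : ℝ) ^ R := one_le_pow₀ (by exact_mod_cast (by omega : 1 ≤ D))
    -- From `n ≤ (D ^ R)!` follows `log (log n) ≤ 2 * R * log D`, hence `T n ≤ R / 2`.
    have e1 : Real.log n ≤ (D : ℝ) ^ R * (D : ℝ) ^ R := by
      calc Real.log n ≤ Real.log (((D : ℝ) ^ R) ^ (D ^ R)) := by
            refine Real.log_le_log hn0 ?_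
            exact_mod_cast hn.trans (Nat.factorial_le_pow _)
        _ = (D : ℝ) ^ R * Real.log ((D : ℝ) ^ R) := by rw [Real.log_pow]; push_cast; rfl
        _ ≤ _ := by
            gcongr
            exact (Real.log_le_sub_one_of_pos (by linarith)).trans (by linarith)
    have e2 : Real.log (Real.log n) ≤ 2 * R * Real.log D := by
      calc Real.log (Real.log n) ≤ Real.log ((D : ℝ) ^ R * (D : ℝ) ^ R) :=
            Real.log_le_log (by linarith) e1
        _ = _ := by rw [← pow_add, Real.log_pow]; push_cast; ring
    have e3 : Real.log D ≤ Real.log K :=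
      Real.log_le_log (by exact_mod_cast (by omega : 0 < D)) (by exact_mod_cast hK)
    have e4 : (T n : ℝ) * Real.log K ≤ (R / 2 : ℝ) * Real.log K := by
      have : (R : ℝ) * Real.log D ≤ R * Real.log K := by gcongr
      linarith
    have e5 : (T n : ℝ) ≤ R / 2 := le_of_mul_le_mul_right e4 hKpos
    have e6 : (2 : ℝ) ≤ R := by exact_mod_cast hR
    exact_mod_cast (by linarith : (T n : ℝ) + 1 ≤ R)
  · set U := Real.log n with hU
    have f1 : ((K : ℝ) ^ T n) ≤ Real.sqrt U := by
      rw [← Real.exp_log (Real.sqrt_pos.2 (by linarith : 0 < U)), Real.log_sqrt (by linarith),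
        ← Real.exp_log (show 0 < (K : ℝ) ^ T n from pow_pos (by exact_mod_cast (by omega)) _),
        Real.log_pow]
      exact Real.exp_le_exp.2 (by linarith)
    have hML : 0 ≤ Real.log M := Real.log_nonneg hM
    -- One factor `sqrt (log n)` bounds `K ^ T n`, the other absorbs `log M / c`.
    have f2 : Real.log M / c ≤ Real.sqrt U := Real.le_sqrt_of_sq_le h3
    have f3 : (K : ℝ) ^ T n * Real.log M ≤ c * U := by
      calc (K : ℝ) ^ T n * Real.log M ≤ Real.sqrt U * (c * Real.sqrt U) := by
            gcongr
            rw [div_le_iff₀ hc] at f2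
            linarith
        _ = c * (Real.sqrt U * Real.sqrt U) := by ring
        _ = c * U := by rw [Real.mul_self_sqrt (by linarith)]
    rw [inv_pow, one_div]
    refine inv_anti₀ (by positivity) ?_
    rw [← Real.log_le_log_iff (by positivity) (by positivity), Real.log_pow, Real.log_rpow hn0]
    push_cast
    exact f3

end Asymptotics

end Distributed

theorem mainTheorem5 (d : ℕ) (hd : 3 ≤ d) (c : ℝ) (hc : 0 < c) :
    ¬ ∃ (A : Distributed.LocalAlgorithm.{u, v} d (Fin d → Bool)) (T : ℕ → ℕ),
      ((fun n : ℕ => (T n : ℝ)) =o[atTop] fun n : ℕ => Real.log (Real.log (n : ℝ))) ∧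
        Distributed.SolvesSinklessOrientation A T c := by
  classical
  rintro ⟨A, T, hT, n₀, hA⟩
  obtain ⟨n₁, hn₁⟩ :=
    eventually_atTop.1 (Distributed.eventually_of_isLittleO (M := (2 * d + 3 : ℝ) ^ 2)
    (D := d + 1) (K := 6 * (d + 1)) hc (one_le_pow₀ (by linarith [(d.cast_nonneg : (0 : ℝ) ≤ d)]))
    (by omega) (by omega) hT)
  -- The group has at least `R` elements, so this choice passes both thresholds.
  let R := n₀ + n₁ + 2
  have hs := Distributed.freeUpTo_treeGen d R
  have hR : 1 ≤ R := by omega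
  have : Fintype (Distributed.TreeGroup d R) := Fintype.ofFinite _
  have h1 := Distributed.le_card_treeGroup (d := d) (by omega) R
  have h2 := Distributed.card_treeGroup_le d R
  rw [Nat.card_eq_fintype_card] at h1 h2
  obtain ⟨h3, h4⟩ := hn₁ (Fintype.card (Distributed.TreeGroup d R)) (by omega) R (by omega) h2
  obtain ⟨h5, h6⟩ := hA (Distributed.TreeGroup d R) (hs.cayleyGraph hR)
    (hs.cayleyColouring hR) (by omega)
    (hs.connected_cayleyGraph hR (Distributed.closure_treeGen d R))
    (hs.isRegularOfDegree_cayleyGraph hR)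
  have h7 := hs.measure_isSinklessOutput_lt hR (by omega) h3 A h5
  linarith
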